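/- Let $n\ge 0$. Let $W\subset\mathbb C^n\times\mathbb C^n$ be an open set of parameters $(\lambda;s)$ with $\lambda_i\ne\lambda_j$ for $i\neq j$ and all $s_i\neq0$, and let $\Omega$ be an open set of points $(z,\lambda;s)\in\mathbb C\times W$ with $z\neq\lambda_i$ for all $i$. Let $Y$ be a holomorphic function on $\Omega$ with values in the invertible complex $2\times2$ matrices (a local fundamental solution), satisfying the isomonodromic deformation equations with double poles $$\partial_z Y=A\,Y,\quad A(z,\lambda;s)=\sum_{i=1}^n\Big(\frac{A_{i,0}(\lambda;s)}{z-\lambda_i}+\frac{A_{i,1}(\lambda;s)}{(z-\lambda_i)^2}\Big),$$ $$\partial_{\lambda_i}Y=-\Big(\frac{A_{i,1}}{(z-\lambda_i)^2}+\frac{A_{i,0}}{z-\lambda_i}\Big)Y,\qquad s_i\,\partial_{s_i}Y=-\frac{A_{i,1}}{z-\lambda_i}\,Y,\qquad 1\le i\le n,$$ where $A_{i,k}(\lambda;s)\in\mathfrak{sl}_2(\mathbb C)$, where $A_{i,1}$ is diagonalizable with eigenvalues $\pm s_i$ (the Birkhoff invariants), and where the exponents of formal monodromy $\pm\alpha_i\in\mathbb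 C$ are constant; the sign of $\alpha_i$ is fixed by $s_i$, namely, for each $(\lambda;s)\in W$ the equation $\partial_zY=AY$ has at $\lambda_i$ a formal fundamental solution $$G_i\Big(\mathbf 1+\sum_{j\ge1}N_j(z-\lambda_i)^j\Big)(z-\lambda_i)^{\mathrm{diag}(\alpha_i,-\alpha_i)}\exp\Big(-\frac{\mathrm{diag}(s_i,-s_i)}{z-\lambda_i}\Big),\qquad G_i\in \mathrm{GL}_2(\mathbb C).$$ Let $\tau$ be a tau-function of this system, that is, a non-vanishing holomorphic function on $W$ with $$\partial_{\lambda_i}\log\tau=\tfrac12\operatorname*{Res}_{z=\lambda_i}\mathrm{Tr}\big(A(z,\lambda;s)^2\big),\qquad \partial_{s_i}\log\tau=-2\operatorname*{Res}_{z=\lambda_i}\frac{\sigma_i(z)}{z-\lambda_i},$$ where $\sigma_i$ is the meromorphic branch near $\lambda_i$ of the solution of $\det(A(z,\lambda;s)-\sigma\mathbf 1)=0$ with $s_i=-\operatorname*{Res}_{z=\lambda_i}(z-\lambda_i)\sigma_i(z)$. With the Wirtinger derivatives $\partial_{\lambda_i},\partial_{s_i}$, put $$\mathcal L=\sum_{i=1}^n\Big(\frac{1}{z-\lambda_i}\partial_{\lambda_i}+\frac{s_i}{(z-\lambda_i)^2}\partial_{s_i}+\frac{\alpha_i^2}{(z-\lambda_i)^2}+\frac{2s_i\alpha_i}{(z-\lambda_i)^3}+\frac{s_i^2}{(z-\lambda_i)^4}\Big).$$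 Then: (1) The function $\mathscr Z(z,\xi,\lambda;s)=\tau(\lambda;s)\,\mathrm{Tr}\big(Y^{-1}(\xi,\lambda;s)\,Y(z,\lambda;s)\big)$, defined for real $z\neq\xi$ with $(z,\lambda;s),(\xi,\lambda;s)\in\Omega$, is $C^2$ in $z$, $C^1$ in $\xi$ (with $\mathscr Z,\partial_z\mathscr Z,\partial_z^2\mathscr Z,\partial_\xi\mathscr Z$ jointly continuous), holomorphic in $(\lambda;s)$, and solves $$\Big[\partial_z^2-\frac1{z-\xi}\big(\partial_z+\partial_\xi\big)-\mathcal L\Big]\mathscr Z(z,\xi,\lambda;s)=0.$$ (2) The function $\mathscr Z(z,\lambda;s)=\tau(\lambda;s)\,\mathrm{Tr}\,Y(z,\lambda;s)$, defined for real $z$ with $(z,\lambda;s)\in\Omega$, is $C^2$, holomorphic in $(\lambda;s)$, and solves the confluent BPZ equation $$\big[\partial_z^2-\mathcal L\big]\mathscr Z(z,\lambda;s)=0.$$ -/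

import Mathlib

open Filter Topology

noncomputable section

namespace IrregularBPZ

/-- Complex `2 × 2` matrices. -/
abbrev Mat2 := Matrix (Fin 2) (Fin 2) ℂ

/-- The deformation parameters `(λ ; s)`: pole positions `p.1` and Birkhoff invariants `p.2`. -/
abbrev Param (n : ℕ) := (Fin n → ℂ) × (Fin n → ℂ)

/-- The diagonal matrix with entries `c, -c`. -/
def diagPM (c : ℂ) : Mat2 := Matrix.diagonal ![c, -c]

/-- The Wirtinger derivative `∂f/∂w = (∂f/∂(Re w) - i ∂f/∂(Im w)) / 2`. -/
def wirtinger (f : ℂ → ℂ) (w : ℂ) : ℂ :=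
  (1 / 2) * (deriv (fun t : ℝ => f (w + t)) 0
    - Complex.I * deriv (fun t : ℝ => f (w + t * Complex.I)) 0)

/-- The residue at an isolated singularity `c`: the value of `(2πi)⁻¹ ∮ f` over small circles
around `c`. -/
def residue (f : ℂ → ℂ) (c : ℂ) : ℂ :=
  limUnder (𝓝[>] (0 : ℝ)) fun r : ℝ =>
    (2 * Real.pi * Complex.I)⁻¹ * ∮ z in C(c, r), f z

variable {n : ℕ}

/-- The Lax matrix `A(z,λ;s) = ∑ᵢ (A_{i,0} / (z - λᵢ) + A_{i,1} / (z - λᵢ)²)`. -/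
def laxMatrix (A : Fin n → Fin 2 → Param n → Mat2) (z : ℂ) (p : Param n) : Mat2 :=
  ∑ i, ((z - p.1 i)⁻¹ • A i 0 p + ((z - p.1 i) ^ 2)⁻¹ • A i 1 p)

/-- The matrix `Uᵢ` of the deformation equation in the pole position `λᵢ`. -/
def laxU (A : Fin n → Fin 2 → Param n → Mat2) (i : Fin n) (z : ℂ) (p : Param n) : Mat2 :=
  -(((z - p.1 i) ^ 2)⁻¹ • A i 1 p) - (z - p.1 i)⁻¹ • A i 0 p

/-- The matrix `Vᵢ`, with `sᵢ Vᵢ = - A_{i,1} / (z - λᵢ)`, of the deformation equation in `sᵢ`. -/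
def laxV (A : Fin n → Fin 2 → Param n → Mat2) (i : Fin n) (z : ℂ) (p : Param n) : Mat2 :=
  -((p.2 i)⁻¹ • (z - p.1 i)⁻¹ • A i 1 p)

open PowerSeries in
/-- The Taylor series of `u² A(λᵢ + u, λ; s)` at `u = 0`. -/
def laxSeries (A : Fin n → Fin 2 → Param n → Mat2) (i : Fin n) (p : Param n) :
    Matrix (Fin 2) (Fin 2) (PowerSeries ℂ) :=
  (A i 1 p).map (C (R := ℂ)) + (X : PowerSeries ℂ) • (A i 0 p).map (C (R := ℂ))
    + (X : PowerSeries ℂ) ^ 2 • ∑ j ∈ Finset.univ.erase i,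
      ((X + C (p.1 i - p.1 j))⁻¹ • (A j 0 p).map (C (R := ℂ))
        + ((X + C (p.1 i - p.1 j))⁻¹) ^ 2 • (A j 1 p).map (C (R := ℂ)))

open PowerSeries in
/-- With `u = z - λᵢ`, the equation `∂Y/∂z = A Y` has a formal fundamental solution
`F(u) u^{diag(a,-a)} exp (- diag(sᵢ,-sᵢ) / u)` at `λᵢ`, where `F = G (1 + N₁ u + N₂ u² + ⋯)` is a
matrix formal power series with invertible constant term `G`. That is,
`u² F' + F (u diag(a,-a) + diag(sᵢ,-sᵢ)) = u² A F`. The constant terms give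
`A_{i,1} = G diag(sᵢ,-sᵢ) G⁻¹`; `a` is the exponent of formal monodromy at `λᵢ`. -/
def HasFormalExponent (A : Fin n → Fin 2 → Param n → Mat2) (i : Fin n) (p : Param n)
    (a : ℂ) : Prop :=
  ∃ F : Matrix (Fin 2) (Fin 2) (PowerSeries ℂ),
    IsUnit (F.map (constantCoeff (R := ℂ))).det ∧
    (X : PowerSeries ℂ) ^ 2 • F.map (derivative ℂ)
      + (X : PowerSeries ℂ) • (F * (diagPM a).map (C (R := ℂ)))
      + F * (diagPM (p.2 i)).map (C (R := ℂ)) = laxSeries A i p * F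

/-- `Y` is a local fundamental solution, holomorphic on the domain `Ω` of points `(z,λ;s)`, of the
isomonodromic deformation equations with traceless coefficients `A_{i,k}(λ;s)`, Birkhoff
invariants `sᵢ` and constant exponents of formal monodromy `αᵢ`; parameters range over `W`. -/
structure IsIsomonodromicSolution (W : Set (Param n)) (Ω : Set (ℂ × Param n)) (α : Fin n → ℂ)
    (A : Fin n → Fin 2 → Param n → Mat2) (Y : ℂ × Param n → Mat2) : Prop where
  traceless : ∀ p ∈ W, ∀ i k, (A i k p).trace = 0
  formal : ∀ p ∈ W, ∀ i, HasFormalExponent A i p (α i)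
  holomorphic : ∀ a b, AnalyticOnNhd ℂ (fun x => Y x a b) Ω
  invertible : ∀ x ∈ Ω, IsUnit (Y x).det
  eq_z : ∀ z l s, (z, l, s) ∈ Ω → ∀ a b,
    HasDerivAt (fun w => Y (w, l, s) a b) ((laxMatrix A z (l, s) * Y (z, l, s)) a b) z
  eq_pole : ∀ z l s, (z, l, s) ∈ Ω → ∀ i a b,
    HasDerivAt (fun w => Y (z, Function.update l i w, s) a b)
      ((laxU A i z (l, s) * Y (z, l, s)) a b) (l i)
  eq_birkhoff : ∀ z l s, (z, l, s) ∈ Ω → ∀ i a b,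
    HasDerivAt (fun w => Y (z, l, Function.update s i w) a b)
      ((laxV A i z (l, s) * Y (z, l, s)) a b) (s i)

/-- `σ` is the branch near `λᵢ` of the eigenvalue of the Lax matrix for which
`sᵢ = - Res_{z=λᵢ} (z - λᵢ) σ(z)`. -/
structure IsSpectralBranch (A : Fin n → Fin 2 → Param n → Mat2) (i : Fin n) (p : Param n)
    (σ : ℂ → ℂ) : Prop where
  meromorphic : MeromorphicAt σ (p.1 i)
  char : ∀ᶠ z in 𝓝[≠] (p.1 i), (laxMatrix A z p - σ z • (1 : Mat2)).det = 0
  normalized : p.2 i = -residue (fun z => (z - p.1 i) * σ z) (p.1 i)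

/-- The Hamiltonian `H_{λᵢ} = ½ Res_{z=λᵢ} Tr A(z)²`. -/
def hamiltonianPole (A : Fin n → Fin 2 → Param n → Mat2) (i : Fin n) (p : Param n) : ℂ :=
  (1 / 2) * residue (fun z => ((laxMatrix A z p) ^ 2).trace) (p.1 i)

/-- `h` is the Hamiltonian `H_{sᵢ} = -2 Res_{z=λᵢ} σ(z) / (z - λᵢ)`. -/
def IsHamiltonianBirkhoff (A : Fin n → Fin 2 → Param n → Mat2) (i : Fin n) (p : Param n)
    (h : ℂ) : Prop :=
  ∃ σ : ℂ → ℂ, IsSpectralBranch A i p σ ∧ h = -2 * residue (fun z => σ z / (z - p.1 i)) (p.1 i)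

/-- `τ` is a tau-function on `W`: holomorphic and non-vanishing, with `∂ log τ / ∂λᵢ = H_{λᵢ}` and
`∂ log τ / ∂sᵢ = H_{sᵢ}`. -/
structure IsTauFunction (W : Set (Param n)) (A : Fin n → Fin 2 → Param n → Mat2)
    (τ : Param n → ℂ) : Prop where
  holomorphic : AnalyticOnNhd ℂ τ W
  ne_zero : ∀ p ∈ W, τ p ≠ 0
  eq_pole : ∀ l s, (l, s) ∈ W → ∀ i,
    logDeriv (fun w => τ (Function.update l i w, s)) (l i) = hamiltonianPole A i (l, s)
  eq_birkhoff : ∀ l s, (l, s) ∈ W → ∀ i,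
    IsHamiltonianBirkhoff A i (l, s) (logDeriv (fun w => τ (l, Function.update s i w)) (s i))

/-- The class `C²_hol(D)`: `C²` functions of `(z, λ; s)`, `z` real, holomorphic in `(λ; s)`. -/
structure IsC2Hol (D : Set (ℝ × Param n)) (f : ℝ × Param n → ℂ) : Prop where
  contDiffOn : ContDiffOn ℝ 2 f D
  holomorphic : ∀ z p, (z, p) ∈ D → AnalyticAt ℂ (fun q => f (z, q)) p

/-- The class `C^{2,1}_hol(D)`: functions of `(z, ξ, λ; s)`, `z` and `ξ` real, that are `C²` in `z`,
`C¹` in `ξ` (with jointly continuous derivatives) and holomorphic in `(λ; s)`. -/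
structure IsC21Hol (D : Set (ℝ × ℝ × Param n)) (f : ℝ × ℝ × Param n → ℂ) : Prop where
  contDiffAt_z : ∀ z ξ p, (z, ξ, p) ∈ D → ContDiffAt ℝ 2 (fun t : ℝ => f (t, ξ, p)) z
  contDiffAt_ξ : ∀ z ξ p, (z, ξ, p) ∈ D → ContDiffAt ℝ 1 (fun t : ℝ => f (z, t, p)) ξ
  holomorphic : ∀ z ξ p, (z, ξ, p) ∈ D → AnalyticAt ℂ (fun q => f (z, ξ, q)) p
  continuousOn : ContinuousOn f D
  continuousOn_dz : ContinuousOn (fun x => deriv (fun t : ℝ => f (t, x.2)) x.1) D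
  continuousOn_dzz : ContinuousOn (fun x => iteratedDeriv 2 (fun t : ℝ => f (t, x.2)) x.1) D
  continuousOn_dξ : ContinuousOn (fun x => deriv (fun t : ℝ => f (x.1, t, x.2.2)) x.2.1) D

/-- The zeroth and first order part common to both equations, applied to `f` at `(λ; s)`:
`∑ᵢ ((z-λᵢ)⁻¹ ∂_{λᵢ} + sᵢ (z-λᵢ)⁻² ∂_{sᵢ} + αᵢ² (z-λᵢ)⁻² + 2 sᵢ αᵢ (z-λᵢ)⁻³ + sᵢ² (z-λᵢ)⁻⁴) f`. -/
def bpzSum (α : Fin n → ℂ) (z : ℂ) (f : Param n → ℂ) (l s : Fin n → ℂ) : ℂ :=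
  ∑ i, (1 / (z - l i) * wirtinger (fun w => f (Function.update l i w, s)) (l i)
    + s i / (z - l i) ^ 2 * wirtinger (fun w => f (l, Function.update s i w)) (s i)
    + (α i ^ 2 / (z - l i) ^ 2 + 2 * s i * α i / (z - l i) ^ 3 + s i ^ 2 / (z - l i) ^ 4)
      * f (l, s))

/-- `Z ∈ C²_hol(D)` solves the confluent BPZ equation on `D`. -/
def SolvesConfluentBPZ (α : Fin n → ℂ) (D : Set (ℝ × Param n)) (Z : ℝ × Param n → ℂ) : Prop :=
  IsC2Hol D Z ∧ ∀ z l s, (z, l, s) ∈ D →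
    iteratedDeriv 2 (fun t : ℝ => Z (t, l, s)) z
      - bpzSum α (z : ℂ) (fun p => Z (z, p)) l s = 0

/-- `Z ∈ C^{2,1}_hol(D)` solves on `D` the confluent BPZ equation with additional real
variable `ξ`. -/
def SolvesConfluentBPZForce (α : Fin n → ℂ) (D : Set (ℝ × ℝ × Param n))
    (Z : ℝ × ℝ × Param n → ℂ) : Prop :=
  IsC21Hol D Z ∧ ∀ z ξ l s, (z, ξ, l, s) ∈ D →
    iteratedDeriv 2 (fun t : ℝ => Z (t, ξ, l, s)) z
      - 1 / ((z : ℂ) - (ξ : ℂ)) * (deriv (fun t : ℝ => Z (t, ξ, l, s)) z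
        + deriv (fun t : ℝ => Z (z, t, l, s)) ξ)
      - bpzSum α (z : ℂ) (fun p => Z (z, ξ, p)) l s = 0

end IrregularBPZ

end

/-!
Everything rests on two identities for the Lax matrix `A`. Being a traceless `2 × 2` matrix,
`A² = ½ Tr(A²) 𝟏`; and with `Uᵢ`, `Vᵢ` the coefficients of the deformation equations,
`(A(z) - A(ξ)) / (z - ξ) = ∑ᵢ (Uᵢ(ξ) / (z - λᵢ) + sᵢ Vᵢ(ξ) / (z - λᵢ)²)` (`laxQuotient`), whose
limit at `ξ = z` is `∂A/∂z`. Hence `∂²Y/∂z² = (∂A/∂z + A²) Y` is the vector field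
`∑ᵢ ((z - λᵢ)⁻¹ ∂_{λᵢ} + sᵢ (z - λᵢ)⁻² ∂_{sᵢ})` applied to `Y`, plus `½ Tr(A²) Y`. When `Y(z)` is
replaced by `Y(ξ)⁻¹ Y(z)`, the vector field also differentiates `Y(ξ)⁻¹`, and the extra term is the
difference quotient of `A`, which `(∂_z + ∂_ξ) / (z - ξ)` accounts for.

It remains to see that `½ Tr A(z)²` equals the potential of `𝓛` plus the vector field applied to
`log τ` (`half_trace_sq_eq_sum_hamiltonian`). The left side is a rational function of `z`, vanishing
at infinity, with poles of order four at the `λᵢ`, so only its principal parts matter: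

* the coefficients of orders four and three are `sᵢ²` and `2 sᵢ αᵢ`, by comparing the two leading
  terms of the formal solution at `λᵢ` (`HasFormalExponent.trace_mul`);
* the residue is `H_{λᵢ}`, by definition of this Hamiltonian;
* the coefficient of order two is `αᵢ² + sᵢ H_{sᵢ}`: the spectral branch satisfies
  `σᵢ² = ½ Tr A²`, and squaring `σᵢ = -sᵢ/u² - αᵢ/u - H_{sᵢ}/2 + ⋯` with `u = z - λᵢ` gives it
  (`mul_residue_sqrt`).

The coefficient matrices are not assumed to depend smoothly on the parameters; only `Y` and `τ` are
differentiated in them, and the regularity claims follow from the joint analyticity of both.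
-/

namespace IrregularBPZ

/-! ### Residues and Laurent expansions -/

/-- A function that agrees near `c` with `a/(z-c) + b/(z-c)² + d/(z-c)³ + e/(z-c)⁴` plus an
analytic function has residue `a` at `c`. -/
theorem residue_eq {f g : ℂ → ℂ} {c a b d e : ℂ} (hg : AnalyticAt ℂ g c)
    (h : ∀ᶠ z in 𝓝[≠] c, f z =
      a / (z - c) + b / (z - c) ^ 2 + d / (z - c) ^ 3 + e / (z - c) ^ 4 + g z) :
    residue f c = a := by
  obtain ⟨ε, hε, hfε⟩ := Metric.eventually_nhds_iff_ball.1 (eventually_nhdsWithin_iff.1 h)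
  obtain ⟨δ, hδ, hgδ⟩ := Metric.eventually_nhds_iff_ball.1 hg.eventually_analyticAt
  refine Tendsto.limUnder_eq (tendsto_const_nhds.congr' ?_)
  filter_upwards [Ioo_mem_nhdsGT (lt_min hε hδ)] with r hr
  have hr0 : 0 < r := hr.1
  have hne : ∀ z ∈ Metric.sphere c r, z - c ≠ 0 := fun z hz h0 => by
    have : dist z c = r := hz
    rw [dist_eq_norm, h0, norm_zero] at this
    exact hr0.ne this
  have hpow : ∀ (m : ℤ), CircleIntegrable (fun z => (z - c) ^ m) c r := fun m =>
    circleIntegrable_sub_zpow_iff.2 <| Or.inr <| Or.inr <| by simp [abs_of_pos hr0, hr0.ne]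
  have hcmul : ∀ (x : ℂ) (m : ℤ), CircleIntegrable (fun z => x * (z - c) ^ m) c r :=
    fun x m => (hpow m).const_smul (a := x)
  have hball : Metric.closedBall c r ⊆ Metric.ball c δ :=
    Metric.closedBall_subset_ball (hr.2.trans_le (min_le_right _ _))
  have hgc : ContinuousOn g (Metric.closedBall c r) := fun z hz =>
    (hgδ z (hball hz)).continuousAt.continuousWithinAt
  have hg0 : (∮ z in C(c, r), g z) = 0 :=
    Complex.circleIntegral_eq_zero_of_differentiable_on_off_countable hr0.le
      Set.countable_empty hgc fun z hz =>
        (hgδ z (hball (Metric.ball_subset_closedBall hz.1))).differentiableAt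
  have hgi : CircleIntegrable g c r :=
    (hgc.mono Metric.sphere_subset_closedBall).circleIntegrable hr0.le
  have hz : ∀ m : ℤ, m ≠ -1 → (∮ z in C(c, r), (z - c) ^ m) = 0 := fun m hm =>
    circleIntegral.integral_sub_zpow_of_ne hm c c r
  have key : (∮ z in C(c, r), f z) = a * (2 * Real.pi * Complex.I) := by
    have e1 : (∮ z in C(c, r), f z) = ∮ z in C(c, r),
        (a * (z - c) ^ (-1 : ℤ) + b * (z - c) ^ (-2 : ℤ) + d * (z - c) ^ (-3 : ℤ)
          + e * (z - c) ^ (-4 : ℤ) + g z) := by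
      refine circleIntegral.integral_congr hr0.le fun z hz => ?_
      rw [hfε z ?_ (by simpa [sub_eq_zero] using hne z hz)]
      · simp only [div_eq_mul_inv, zpow_neg, zpow_one]
        rfl
      · have : dist z c = r := hz
        rw [Metric.mem_ball, this]
        exact hr.2.trans_le (min_le_left _ _)
    have i₂ : CircleIntegrable (fun z => a * (z - c) ^ (-1 : ℤ) + b * (z - c) ^ (-2 : ℤ)) c r :=
      (hcmul _ _).add (hcmul _ _)
    have i₃ : CircleIntegrable (fun z => a * (z - c) ^ (-1 : ℤ) + b * (z - c) ^ (-2 : ℤ)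
        + d * (z - c) ^ (-3 : ℤ)) c r := i₂.add (hcmul _ _)
    have i₄ : CircleIntegrable (fun z => a * (z - c) ^ (-1 : ℤ) + b * (z - c) ^ (-2 : ℤ)
        + d * (z - c) ^ (-3 : ℤ) + e * (z - c) ^ (-4 : ℤ)) c r := i₃.add (hcmul _ _)
    rw [e1, circleIntegral.integral_add i₄ hgi, circleIntegral.integral_add i₃ (hcmul _ _),
      circleIntegral.integral_add i₂ (hcmul _ _),
      circleIntegral.integral_add (hcmul _ _) (hcmul _ _), hg0]
    simp only [circleIntegral.integral_const_mul, hz (-2) (by decide), hz (-3) (by decide),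
      hz (-4) (by decide), zpow_neg_one, circleIntegral.integral_sub_center_inv c hr0.ne']
    ring
  rw [key]
  field_simp [Complex.I_ne_zero, Real.pi_ne_zero]

/-- First order Taylor expansion with analytic remainder. -/
theorem _root_.AnalyticAt.exists_eq_add_mul {f : ℂ → ℂ} {c : ℂ} (hf : AnalyticAt ℂ f c) :
    ∃ g : ℂ → ℂ, AnalyticAt ℂ g c ∧ ∀ z, f z = f c + (z - c) * g z := by
  obtain ⟨p, hp⟩ := hf
  refine ⟨dslope f c, ⟨_, hp.has_fpower_series_dslope_fslope⟩, fun z => ?_⟩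
  have := sub_smul_dslope f c z
  rw [smul_eq_mul] at this
  rw [this]
  ring

/-- The constant term of a vanishing expansion vanishes, and so does the cofactor of `z - c`. -/
theorem eq_zero_of_eventually_add_mul_eq_zero {a c : ℂ} {g : ℂ → ℂ} (hg : ContinuousAt g c)
    (h : ∀ᶠ z in 𝓝[≠] c, a + (z - c) * g z = 0) : a = 0 ∧ ∀ᶠ z in 𝓝[≠] c, g z = 0 := by
  have ha : a = 0 := by
    have hc : ContinuousAt (fun z => a + (z - c) * g z) c := by fun_prop
    have h1 : Tendsto (fun z => a + (z - c) * g z) (𝓝[≠] c) (𝓝 a) := by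
      simpa using hc.tendsto.mono_left nhdsWithin_le_nhds
    exact tendsto_nhds_unique (h1.congr' h) tendsto_const_nhds
  refine ⟨ha, ?_⟩
  filter_upwards [h, self_mem_nhdsWithin] with z hz hzc
  simpa [ha, sub_ne_zero.2 hzc] using hz

/-- A meromorphic square root `σ` of `q`, where `q` has a pole of order four at `c` with leading
coefficients `s²` and `2sα`, expands as `±(s/u² + α/u + O(1))` in `u = z - c`. The residue of `u σ`
selects the minus sign, and the coefficient of `u⁻²` in `q` then determines the constant term
of `σ`. -/
theorem mul_residue_sqrt {q σ g : ℂ → ℂ} {c s α c₂ c₁ : ℂ} (hs : s ≠ 0) (hg : AnalyticAt ℂ g c)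
    (hq : ∀ᶠ z in 𝓝[≠] c, q z =
      c₁ / (z - c) + c₂ / (z - c) ^ 2 + 2 * s * α / (z - c) ^ 3 + s ^ 2 / (z - c) ^ 4 + g z)
    (hσ : MeromorphicAt σ c) (hσq : ∀ᶠ z in 𝓝[≠] c, σ z ^ 2 = q z)
    (hres : s = -residue (fun z => (z - c) * σ z) c) :
    s * (-2 * residue (fun z => σ z / (z - c)) c) = c₂ - α ^ 2 := by
  -- `ψ = u² σ` has the nonzero limit `s²` of squares, hence extends analytically to `c`.
  set ψ : ℂ → ℂ := fun z => (z - c) ^ 2 * σ z with hψ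
  have hψm : MeromorphicAt ψ c := by
    have : MeromorphicAt (fun z : ℂ => (z - c) ^ 2) c := by fun_prop
    exact this.mul hσ
  have hsq : ∀ᶠ z in 𝓝[≠] c, ψ z ^ 2 = s ^ 2 + (z - c) * (2 * s * α + (z - c) *
      (c₂ + (z - c) * (c₁ + (z - c) * g z))) := by
    filter_upwards [hq, hσq, self_mem_nhdsWithin] with z h1 h2 h3
    have h3 : z - c ≠ 0 := sub_ne_zero.2 h3
    rw [hψ, mul_pow, h2, h1]
    field_simp
    ring
  have hord : meromorphicOrderAt ψ c = 0 := by
    have hc : ContinuousAt (fun z => s ^ 2 + (z - c) * (2 * s * α + (z - c) *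
      (c₂ + (z - c) * (c₁ + (z - c) * g z)))) c := by
      have := hg.continuousAt
      fun_prop
    have h0 : meromorphicOrderAt (ψ * ψ) c = 0 := by
      refine (tendsto_ne_zero_iff_meromorphicOrderAt_eq_zero (hψm.mul hψm)).1
        ⟨s ^ 2, pow_ne_zero 2 hs, ?_⟩
      have := hc.tendsto.mono_left (nhdsWithin_le_nhds (s := {c}ᶜ))
      simp only [sub_self, zero_mul, add_zero] at this
      refine this.congr' (hsq.mono fun z hz => ?_)
      rw [← hz, Pi.mul_apply, sq]
    rw [meromorphicOrderAt_mul hψm hψm] at h0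
    cases hm : meromorphicOrderAt ψ c with
    | top => simp [hm] at h0
    | coe m =>
      rw [hm] at h0
      norm_cast at h0 ⊢
      omega
  obtain ⟨φ, hφ, -, hφψ⟩ := (meromorphicOrderAt_eq_int_iff (n := 0) hψm).1 (by simpa using hord)
  obtain ⟨φ₁, hφ₁, e0⟩ := hφ.exists_eq_add_mul
  obtain ⟨φ₂, hφ₂, e1⟩ := hφ₁.exists_eq_add_mul
  obtain ⟨φ₃, hφ₃, e2⟩ := hφ₂.exists_eq_add_mul
  set x := φ c
  set y := φ₁ c
  set w := φ₂ c
  have hσφ : ∀ᶠ z in 𝓝[≠] c,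
      σ z = (x + (z - c) * (y + (z - c) * (w + (z - c) * φ₃ z))) / (z - c) ^ 2 := by
    filter_upwards [hφψ, self_mem_nhdsWithin] with z h1 h3
    have h3 : z - c ≠ 0 := sub_ne_zero.2 h3
    rw [← e2, ← e1, ← e0, eq_div_iff (pow_ne_zero 2 h3), mul_comm]
    simpa using h1
  have hx : residue (fun z => (z - c) * σ z) c = x := by
    refine residue_eq (b := 0) (d := 0) (e := 0) hφ₁ ?_
    filter_upwards [hσφ, self_mem_nhdsWithin] with z h1 h3
    have h3 : z - c ≠ 0 := sub_ne_zero.2 h3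
    rw [h1, ← e2, ← e1]
    field_simp
    ring
  have hw : residue (fun z => σ z / (z - c)) c = w := by
    refine residue_eq (b := y) (d := x) (e := 0) hφ₃ ?_
    filter_upwards [hσφ, self_mem_nhdsWithin] with z h1 h3
    have h3 : z - c ≠ 0 := sub_ne_zero.2 h3
    rw [h1]
    field_simp
    ring
  have hcmp : ∀ᶠ z in 𝓝[≠] c, (x ^ 2 - s ^ 2) + (z - c) * ((2 * x * y - 2 * s * α) + (z - c) *
      ((2 * x * w + y ^ 2 - c₂) + (z - c) * (2 * x * φ₃ z + 2 * y * w - c₁ + (z - c) *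
        (2 * y * φ₃ z + w ^ 2 - g z + (z - c) * (2 * w * φ₃ z + (z - c) * φ₃ z ^ 2))))) = 0 := by
    filter_upwards [hsq, hφψ] with z h1 h2
    have h2 : ψ z = x + (z - c) * (y + (z - c) * (w + (z - c) * φ₃ z)) := by
      rw [← e2, ← e1, ← e0]
      simpa using h2
    rw [h2] at h1
    linear_combination h1
  have hφc := hφ₃.continuousAt
  have hgc := hg.continuousAt
  obtain ⟨-, h1⟩ := eq_zero_of_eventually_add_mul_eq_zero (by fun_prop) hcmp
  obtain ⟨k1, h2⟩ := eq_zero_of_eventually_add_mul_eq_zero (by fun_prop) h1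
  obtain ⟨k2, -⟩ := eq_zero_of_eventually_add_mul_eq_zero (by fun_prop) h2
  have hxs : x = -s := by rw [hres, hx, neg_neg]
  rw [hxs] at k1 k2
  have hy : y = -α := by
    have : s * (y + α) = 0 := by linear_combination (-1 / 2) * k1
    rcases mul_eq_zero.1 this with h | h
    · exact absurd h hs
    · linear_combination h
  rw [hw]
  rw [hy] at k2
  linear_combination k2

variable {n : ℕ}

/-! ### The local data of the Lax matrix -/

/-- The two leading coefficients of the formal solution conjugate `A_{i,1}` to `diag(s, -s)` and
`A_{i,0}` to `diag(a, -a)` up to a commutator with `diag(s, -s)`, which the traces do not see. -/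
theorem HasFormalExponent.trace_mul {A : Fin n → Fin 2 → Param n → Mat2} {i : Fin n}
    {p : Param n} {a : ℂ} (h : HasFormalExponent A i p a) :
    (A i 1 p * A i 1 p).trace = 2 * p.2 i ^ 2 ∧ (A i 0 p * A i 1 p).trace = 2 * p.2 i * a := by
  obtain ⟨F, hF, h⟩ := h
  rw [laxSeries, Matrix.add_mul, Matrix.add_mul, Matrix.smul_mul, Matrix.smul_mul] at h
  generalize (∑ j ∈ Finset.univ.erase i, _ : Matrix (Fin 2) (Fin 2) (PowerSeries ℂ)) = R at h
  set G := F.map (PowerSeries.constantCoeff (R := ℂ)) with hG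
  set N := F.map (PowerSeries.coeff (R := ℂ) 1) with hN
  have h0 : G * diagPM (p.2 i) = A i 1 p * G := by
    ext k l
    have := congrArg (PowerSeries.constantCoeff (R := ℂ)) (congrFun (congrFun h k) l)
    simpa [Matrix.mul_apply, Fin.sum_univ_two, hG] using this
  have h1 : G * diagPM a + N * diagPM (p.2 i) = A i 1 p * N + A i 0 p * G := by
    ext k l
    have := congrArg (PowerSeries.coeff (R := ℂ) 1) (congrFun (congrFun h k) l)
    simpa [Matrix.mul_apply, Fin.sum_univ_two, hG, hN, PowerSeries.coeff_X_pow_mul']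
      using this
  set D := diagPM (p.2 i) with hD
  set E := diagPM a with hE
  have hGi : G * G⁻¹ = 1 := Matrix.mul_nonsing_inv G hF
  have hiG : G⁻¹ * G = 1 := Matrix.nonsing_inv_mul G hF
  have hA1 : A i 1 p = G * D * G⁻¹ := by rw [h0, Matrix.mul_assoc, hGi, Matrix.mul_one]
  have hA0 : A i 0 p = (G * E + N * D - A i 1 p * N) * G⁻¹ := by
    rw [h1, add_sub_cancel_left, Matrix.mul_assoc, hGi, Matrix.mul_one]
  have hDD : (D * D).trace = 2 * p.2 i ^ 2 := by
    simp [hD, diagPM]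
    ring
  have hED : (E * D).trace = 2 * p.2 i * a := by
    simp [hD, hE, diagPM]
    ring
  have hiA : G⁻¹ * A i 1 p = D * G⁻¹ := by
    rw [hA1, ← Matrix.mul_assoc, ← Matrix.mul_assoc, hiG, Matrix.one_mul]
  have hconj : ∀ B : Mat2, (G * B * G⁻¹).trace = B.trace := fun B => by
    rw [Matrix.trace_mul_comm, ← Matrix.mul_assoc, hiG, Matrix.one_mul]
  constructor
  · rw [← hDD, ← hconj (D * D)]
    nth_rw 1 [hA1]
    rw [Matrix.mul_assoc, hiA]
    simp only [Matrix.mul_assoc]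
  · have hA01 : A i 0 p * A i 1 p = G * (E * D) * G⁻¹ + (N * D * D * G⁻¹
        - A i 1 p * (N * D * G⁻¹)) := by
      nth_rw 1 [hA0]
      rw [Matrix.mul_assoc, hiA]
      simp only [Matrix.add_mul, Matrix.sub_mul, Matrix.mul_assoc, add_sub_assoc]
    rw [hA01, Matrix.trace_add, hconj, hED, Matrix.trace_sub, Matrix.trace_mul_comm (A i 1 p),
      Matrix.mul_assoc (N * D) G⁻¹, hiA, ← Matrix.mul_assoc, sub_self, add_zero]

theorem trace_laxMatrix {A : Fin n → Fin 2 → Param n → Mat2} {p : Param n}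
    (h : ∀ i k, (A i k p).trace = 0) (z : ℂ) : (laxMatrix A z p).trace = 0 := by
  simp [laxMatrix, Matrix.trace_sum, h]

theorem trace_laxU {A : Fin n → Fin 2 → Param n → Mat2} {p : Param n}
    (h : ∀ i k, (A i k p).trace = 0) (i : Fin n) (z : ℂ) : (laxU A i z p).trace = 0 := by
  simp [laxU, h]

theorem trace_laxV {A : Fin n → Fin 2 → Param n → Mat2} {p : Param n}
    (h : ∀ i k, (A i k p).trace = 0) (i : Fin n) (z : ℂ) : (laxV A i z p).trace = 0 := by
  simp [laxV, h]

/-- A traceless `2 × 2` matrix squares to a scalar. -/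
theorem sq_eq_of_trace_eq_zero {B : Mat2} (h : B.trace = 0) :
    B * B = (1 / 2 * (B ^ 2).trace) • (1 : Mat2) := by
  rw [Matrix.trace_fin_two] at h
  have h' : B 1 1 = -B 0 0 := by linear_combination h
  ext k l
  fin_cases k <;> fin_cases l <;>
    simp [sq, Matrix.mul_apply, Matrix.trace_fin_two, Fin.sum_univ_two, h'] <;> ring

/-- The coefficient of `(z - λᵢ)⁻¹` in `½ Tr A(z)²`. Here and in `poleCoeffTwo` the term `j = i`
of the sum vanishes, by the convention `x / 0 = 0`. -/
noncomputable def poleCoeffOne (A : Fin n → Fin 2 → Param n → Mat2) (i : Fin n) (p : Param n) : ℂ :=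
  ∑ j, ((A i 0 p * A j 0 p).trace / (p.1 i - p.1 j)
    + ((A i 0 p * A j 1 p).trace - (A i 1 p * A j 0 p).trace) / (p.1 i - p.1 j) ^ 2
    - 2 * (A i 1 p * A j 1 p).trace / (p.1 i - p.1 j) ^ 3)

/-- The coefficient of `(z - λᵢ)⁻²` in `½ Tr A(z)²`. -/
noncomputable def poleCoeffTwo (A : Fin n → Fin 2 → Param n → Mat2) (i : Fin n) (p : Param n) : ℂ :=
  1 / 2 * (A i 0 p * A i 0 p).trace
    + ∑ j, ((A i 1 p * A j 0 p).trace / (p.1 i - p.1 j)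
      + (A i 1 p * A j 1 p).trace / (p.1 i - p.1 j) ^ 2)

/-- Partial fraction decomposition of `½ Tr A(z)²`. -/
theorem half_trace_sq_laxMatrix {A : Fin n → Fin 2 → Param n → Mat2} {p : Param n}
    (hp : Function.Injective p.1) {z : ℂ} (hz : ∀ i, z ≠ p.1 i) :
    1 / 2 * ((laxMatrix A z p) ^ 2).trace =
      ∑ i, (poleCoeffOne A i p / (z - p.1 i) + poleCoeffTwo A i p / (z - p.1 i) ^ 2
        + (A i 0 p * A i 1 p).trace / (z - p.1 i) ^ 3
        + 1 / 2 * (A i 1 p * A i 1 p).trace / (z - p.1 i) ^ 4) := by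
  set T : Fin n → Fin 2 → Fin n → Fin 2 → ℂ := fun i k j m => (A i k p * A j m p).trace with hT
  have hsymm : ∀ i k j m, T i k j m = T j m i k := fun i k j m => Matrix.trace_mul_comm _ _
  set P : Fin n → Fin n → ℂ := fun i j =>
    (T i 0 j 0 / (p.1 i - p.1 j) + (T i 0 j 1 - T i 1 j 0) / (p.1 i - p.1 j) ^ 2
      - 2 * T i 1 j 1 / (p.1 i - p.1 j) ^ 3) / (z - p.1 i)
    + (T i 1 j 0 / (p.1 i - p.1 j) + T i 1 j 1 / (p.1 i - p.1 j) ^ 2) / (z - p.1 i) ^ 2 with hP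
  set S : Fin n → ℂ := fun i =>
    T i 0 i 0 / (z - p.1 i) ^ 2 + 2 * T i 0 i 1 / (z - p.1 i) ^ 3
      + T i 1 i 1 / (z - p.1 i) ^ 4 with hS
  -- The cross term of two poles splits symmetrically into the contributions of either pole.
  have hpair : ∀ i j, (((z - p.1 i)⁻¹ • A i 0 p + ((z - p.1 i) ^ 2)⁻¹ • A i 1 p) *
      ((z - p.1 j)⁻¹ • A j 0 p + ((z - p.1 j) ^ 2)⁻¹ • A j 1 p)).trace
      = P i j + P j i + if i = j then S i else 0 := by
    intro i j
    have hi := sub_ne_zero.2 (hz i)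
    have hj := sub_ne_zero.2 (hz j)
    have e : (((z - p.1 i)⁻¹ • A i 0 p + ((z - p.1 i) ^ 2)⁻¹ • A i 1 p) *
        ((z - p.1 j)⁻¹ • A j 0 p + ((z - p.1 j) ^ 2)⁻¹ • A j 1 p)).trace
        = (z - p.1 i)⁻¹ * (z - p.1 j)⁻¹ * T i 0 j 0
          + (z - p.1 i)⁻¹ * ((z - p.1 j) ^ 2)⁻¹ * T i 0 j 1
          + ((z - p.1 i) ^ 2)⁻¹ * (z - p.1 j)⁻¹ * T i 1 j 0
          + ((z - p.1 i) ^ 2)⁻¹ * ((z - p.1 j) ^ 2)⁻¹ * T i 1 j 1 := by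
      simp only [Matrix.add_mul, Matrix.mul_add, Matrix.smul_mul, Matrix.mul_smul,
        Matrix.trace_add, Matrix.trace_smul, smul_eq_mul, hT]
      ring
    rw [e]
    by_cases hij : i = j
    · subst hij
      simp only [hP, hS, sub_self, if_true, hsymm i 1 i 0]
      field_simp
      ring
    · have hd := sub_ne_zero.2 (hp.ne hij)
      simp only [hP, if_neg hij, hsymm j]
      generalize T i 0 j 0 = t₀₀
      generalize T i 0 j 1 = t₀₁
      generalize T i 1 j 0 = t₁₀
      generalize T i 1 j 1 = t₁₁
      have hneg : p.1 j - p.1 i = -(p.1 i - p.1 j) := by ring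
      rw [hneg]
      obtain ⟨u, hu⟩ : ∃ u, u = z - p.1 i := ⟨_, rfl⟩
      obtain ⟨d, hd0⟩ : ∃ d, d = p.1 i - p.1 j := ⟨_, rfl⟩
      have hv : z - p.1 j = u + d := by rw [hu, hd0]; ring
      rw [hv] at hj ⊢
      rw [← hu] at hi ⊢
      rw [← hd0] at hd ⊢
      field_simp
      ring
  have hsum : ((laxMatrix A z p) ^ 2).trace = ∑ i, (2 * ∑ j, P i j + S i) := by
    have hS' : ∑ i, ∑ j, (if i = j then S i else 0) = ∑ i, S i := by simp
    rw [sq, laxMatrix, Finset.sum_mul_sum]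
    simp_rw [Matrix.trace_sum, hpair]
    simp only [Finset.sum_add_distrib, ← Finset.mul_sum]
    rw [hS', Finset.sum_comm (f := fun i j => P j i)]
    ring
  rw [hsum, Finset.mul_sum]
  refine Finset.sum_congr rfl fun i _ => ?_
  have hPi : ∑ j, P i j = poleCoeffOne A i p / (z - p.1 i)
      + (poleCoeffTwo A i p - 1 / 2 * T i 0 i 0) / (z - p.1 i) ^ 2 := by
    rw [poleCoeffOne, poleCoeffTwo, add_sub_cancel_left, Finset.sum_div, Finset.sum_div,
      ← Finset.sum_add_distrib]
  rw [hPi]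
  simp only [hS, hT]
  ring

/-- Laurent expansion of `½ Tr A(z)²` at `λᵢ`. -/
theorem half_trace_sq_laxMatrix_laurent {A : Fin n → Fin 2 → Param n → Mat2} {p : Param n}
    (hp : Function.Injective p.1) {i : Fin n} {a : ℂ} (h : HasFormalExponent A i p a) :
    ∃ g : ℂ → ℂ, AnalyticAt ℂ g (p.1 i) ∧ ∀ᶠ z in 𝓝[≠] (p.1 i),
      1 / 2 * ((laxMatrix A z p) ^ 2).trace =
        poleCoeffOne A i p / (z - p.1 i) + poleCoeffTwo A i p / (z - p.1 i) ^ 2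
          + 2 * p.2 i * a / (z - p.1 i) ^ 3 + p.2 i ^ 2 / (z - p.1 i) ^ 4 + g z := by
  refine ⟨fun z => ∑ j ∈ Finset.univ.erase i,
    (poleCoeffOne A j p / (z - p.1 j) + poleCoeffTwo A j p / (z - p.1 j) ^ 2
        + (A j 0 p * A j 1 p).trace / (z - p.1 j) ^ 3
        + 1 / 2 * (A j 1 p * A j 1 p).trace / (z - p.1 j) ^ 4), ?_, ?_⟩
  · refine Finset.analyticAt_fun_sum _ fun j hj => ?_
    have hne : p.1 i - p.1 j ≠ 0 := sub_ne_zero.2 (hp.ne (Finset.ne_of_mem_erase hj).symm)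
    have h2 := pow_ne_zero 2 hne
    have h3 := pow_ne_zero 3 hne
    have h4 := pow_ne_zero 4 hne
    fun_prop (disch := assumption)
  · have hev : ∀ᶠ z in 𝓝[≠] (p.1 i), ∀ j, z ≠ p.1 j := by
      refine eventually_all.2 fun j => ?_
      by_cases hj : j = i
      · subst hj
        exact self_mem_nhdsWithin
      · exact (eventually_ne_nhds (hp.ne (Ne.symm hj))).filter_mono nhdsWithin_le_nhds
    filter_upwards [hev] with z hz
    rw [half_trace_sq_laxMatrix hp hz, ← Finset.add_sum_erase _ _ (Finset.mem_univ i),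
      h.trace_mul.1, h.trace_mul.2]
    ring

theorem hamiltonianPole_eq {A : Fin n → Fin 2 → Param n → Mat2} {p : Param n}
    (hp : Function.Injective p.1) {i : Fin n} {a : ℂ} (h : HasFormalExponent A i p a) :
    hamiltonianPole A i p = poleCoeffOne A i p := by
  obtain ⟨g, hg, he⟩ := half_trace_sq_laxMatrix_laurent hp h
  rw [hamiltonianPole, residue_eq (a := 2 * poleCoeffOne A i p) (b := 2 * poleCoeffTwo A i p)
    (d := 2 * (2 * p.2 i * a)) (e := 2 * p.2 i ^ 2) (g := fun z => 2 * g z) (by fun_prop)]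
  · ring
  · filter_upwards [he] with z hz
    linear_combination 2 * hz

theorem IsHamiltonianBirkhoff.mul_eq {A : Fin n → Fin 2 → Param n → Mat2} {p : Param n}
    (hp : Function.Injective p.1) (htr : ∀ i k, (A i k p).trace = 0) {i : Fin n}
    (hs : p.2 i ≠ 0) {a : ℂ} (h : HasFormalExponent A i p a) {H : ℂ}
    (hH : IsHamiltonianBirkhoff A i p H) : p.2 i * H = poleCoeffTwo A i p - a ^ 2 := by
  obtain ⟨σ, hσ, rfl⟩ := hH
  obtain ⟨g, hg, he⟩ := half_trace_sq_laxMatrix_laurent hp h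
  refine mul_residue_sqrt hs hg he hσ.meromorphic ?_ hσ.normalized
  filter_upwards [hσ.char] with z hz
  have h0 := trace_laxMatrix htr z
  rw [Matrix.trace_fin_two] at h0
  have h' : laxMatrix A z p 1 1 = -laxMatrix A z p 0 0 := by linear_combination h0
  rw [Matrix.det_fin_two] at hz
  simp [h'] at hz
  simp [sq, Matrix.trace_fin_two, Matrix.mul_apply, Fin.sum_univ_two, h']
  linear_combination hz

/-! ### Difference quotients of the Lax matrix -/

/-- The coefficient matrix at `ξ` of the vector field `∑ᵢ ((z-λᵢ)⁻¹ ∂_{λᵢ} + sᵢ (z-λᵢ)⁻² ∂_{sᵢ})`;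
it equals `(A(z) - A(ξ)) / (z - ξ)`, and `∂A/∂z` for `ξ = z`. -/
noncomputable def laxQuotient (A : Fin n → Fin 2 → Param n → Mat2) (z ξ : ℂ) (p : Param n) : Mat2 :=
  ∑ i, ((z - p.1 i)⁻¹ • laxU A i ξ p + (p.2 i / (z - p.1 i) ^ 2) • laxV A i ξ p)

theorem laxMatrix_sub_laxMatrix {A : Fin n → Fin 2 → Param n → Mat2} {p : Param n}
    (hs : ∀ i, p.2 i ≠ 0) {z ξ : ℂ} (hz : ∀ i, z ≠ p.1 i) (hξ : ∀ i, ξ ≠ p.1 i) :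
    laxMatrix A z p - laxMatrix A ξ p = (z - ξ) • laxQuotient A z ξ p := by
  rw [laxMatrix, laxMatrix, laxQuotient, ← Finset.sum_sub_distrib, Finset.smul_sum]
  refine Finset.sum_congr rfl fun i _ => ?_
  have h1 := hs i
  have h2 := sub_ne_zero.2 (hz i)
  have h3 := sub_ne_zero.2 (hξ i)
  ext k l
  simp only [laxU, laxV, Matrix.add_apply, Matrix.sub_apply, Matrix.smul_apply, Matrix.neg_apply,
    smul_eq_mul]
  field_simp
  ring

theorem hasDerivAt_laxMatrix {A : Fin n → Fin 2 → Param n → Mat2} {p : Param n}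
    (hs : ∀ i, p.2 i ≠ 0) {z : ℂ} (hz : ∀ i, z ≠ p.1 i) (k l : Fin 2) :
    HasDerivAt (fun w => laxMatrix A w p k l) (laxQuotient A z z p k l) z := by
  simp only [laxMatrix, laxQuotient, Matrix.sum_apply]
  refine HasDerivAt.fun_sum fun i _ => ?_
  have h1 := hs i
  have h2 := sub_ne_zero.2 (hz i)
  have d1 : HasDerivAt (fun w : ℂ => w - p.1 i) 1 z := (hasDerivAt_id z).sub_const _
  have d2 := (d1.fun_inv h2).mul_const (A i 0 p k l)
  have d3 := ((d1.fun_pow 2).fun_inv (pow_ne_zero 2 h2)).mul_const (A i 1 p k l)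
  refine (d2.fun_add d3).congr_deriv ?_
  simp only [laxU, laxV, Matrix.add_apply, Matrix.sub_apply, Matrix.smul_apply, Matrix.neg_apply,
    smul_eq_mul]
  field_simp
  ring

/-! ### Derivatives of traces -/

theorem hasDerivAt_trace_mul (X : Mat2) {Q : ℂ → Mat2} {Q' : Mat2} {z : ℂ}
    (hQ : ∀ a b, HasDerivAt (fun w => Q w a b) (Q' a b) z) :
    HasDerivAt (fun w => (X * Q w).trace) (X * Q').trace z := by
  simp only [Matrix.trace_fin_two, Matrix.mul_apply, Fin.sum_univ_two]
  exact (((hQ 0 0).const_mul _).add ((hQ 1 0).const_mul _)).add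
    (((hQ 0 1).const_mul _).add ((hQ 1 1).const_mul _))

theorem hasDerivAt_mul_apply {B Q : ℂ → Mat2} {B' Q' : Mat2} {z : ℂ}
    (hB : ∀ a b, HasDerivAt (fun w => B w a b) (B' a b) z)
    (hQ : ∀ a b, HasDerivAt (fun w => Q w a b) (Q' a b) z) (a b : Fin 2) :
    HasDerivAt (fun w => (B w * Q w) a b) ((B' * Q z + B z * Q') a b) z := by
  simp only [Matrix.add_apply, Matrix.mul_apply, ← Finset.sum_add_distrib]
  exact HasDerivAt.fun_sum fun k _ => (hB a k).mul (hQ k b)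

theorem trace_inv_mul (P Q : Mat2) : (P⁻¹ * Q).trace =
    (P 0 0 * P 1 1 - P 0 1 * P 1 0)⁻¹ *
      (P 1 1 * Q 0 0 - P 0 1 * Q 1 0 - P 1 0 * Q 0 1 + P 0 0 * Q 1 1) := by
  rw [Matrix.inv_def, Ring.inverse_eq_inv', Matrix.det_fin_two, Matrix.adjugate_fin_two,
    Matrix.smul_mul, Matrix.trace_smul, smul_eq_mul]
  congr 1
  simp only [Matrix.trace_fin_two, Matrix.mul_apply, Fin.sum_univ_two, Matrix.of_apply,
    Matrix.cons_val', Matrix.cons_val_zero, Matrix.cons_val_one, Matrix.cons_val_fin_one]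
  ring

/-- If `P' = B P` and `Q' = C Q` with `B` traceless, then `Tr (P⁻¹ Q)' = Tr (P⁻¹ (C - B) Q)`. -/
theorem hasDerivAt_trace_inv_mul {P Q : ℂ → Mat2} {B C P₀ Q₀ : Mat2} {z : ℂ} (hB : B.trace = 0)
    (hP₀ : P z = P₀) (hQ₀ : Q z = Q₀) (hdet : IsUnit P₀.det)
    (hP : ∀ a b, HasDerivAt (fun w => P w a b) ((B * P₀) a b) z)
    (hQ : ∀ a b, HasDerivAt (fun w => Q w a b) ((C * Q₀) a b) z) :
    HasDerivAt (fun w => ((P w)⁻¹ * Q w).trace) (P₀⁻¹ * ((C - B) * Q₀)).trace z := by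
  subst hP₀ hQ₀
  have hd := hdet.ne_zero
  rw [Matrix.det_fin_two] at hd
  rw [Matrix.trace_fin_two] at hB
  have hB' : B 1 1 = -B 0 0 := by linear_combination hB
  simp only [trace_inv_mul]
  have d1 := (((hP 0 0).fun_mul (hP 1 1)).fun_sub ((hP 0 1).fun_mul (hP 1 0))).fun_inv hd
  have d2 := ((((hP 1 1).fun_mul (hQ 0 0)).fun_sub ((hP 0 1).fun_mul (hQ 1 0))).fun_sub
    ((hP 1 0).fun_mul (hQ 0 1))).fun_add ((hP 0 0).fun_mul (hQ 1 1))
  refine (d1.fun_mul d2).congr_deriv ?_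
  -- `det P` is constant, since `B` is traceless.
  have hdet' : (B * P z) 0 0 * P z 1 1 + P z 0 0 * (B * P z) 1 1
      - ((B * P z) 0 1 * P z 1 0 + P z 0 1 * (B * P z) 1 0) = 0 := by
    simp only [Matrix.mul_apply, Fin.sum_univ_two, hB']
    ring
  rw [hdet', neg_zero, zero_div, zero_mul, zero_add]
  congr 1
  simp only [Matrix.mul_apply, Matrix.sub_apply, Fin.sum_univ_two, hB']
  ring

theorem wirtinger_eq_of_hasDerivAt {f : ℂ → ℂ} {f' w : ℂ} (h : HasDerivAt f f' w) :
    wirtinger f w = f' := by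
  have h1 : HasDerivAt (fun t : ℝ => f (w + t)) f' 0 := by
    have : HasDerivAt (fun t : ℂ => f (w + t)) f' ((0 : ℝ) : ℂ) :=
      HasDerivAt.comp_const_add w _ (by simpa using h)
    exact this.comp_ofReal
  have h2 : HasDerivAt (fun t : ℝ => f (w + t * Complex.I)) (f' * Complex.I) 0 := by
    have hl : HasDerivAt (fun t : ℂ => w + t * Complex.I) Complex.I ((0 : ℝ) : ℂ) := by
      simpa using ((hasDerivAt_id ((0 : ℝ) : ℂ)).mul_const Complex.I).const_add w
    have : HasDerivAt (fun t : ℂ => f (w + t * Complex.I)) (f' * Complex.I) ((0 : ℝ) : ℂ) :=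
      HasDerivAt.comp _ (by simpa using h) hl
    exact this.comp_ofReal
  rw [wirtinger, h1.deriv, h2.deriv]
  linear_combination (-1 / 2 * f') * Complex.I_mul_I

theorem iteratedDeriv_two_comp_ofReal {f f' : ℂ → ℂ} {f'' : ℂ} {z : ℝ}
    (h1 : ∀ᶠ w in 𝓝 (z : ℂ), HasDerivAt f (f' w) w) (h2 : HasDerivAt f' f'' z) :
    iteratedDeriv 2 (fun t : ℝ => f t) z = f'' := by
  rw [iteratedDeriv_succ, iteratedDeriv_one]
  have he : deriv (fun t : ℝ => f t) =ᶠ[𝓝 z] fun t : ℝ => f' t :=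
    (Complex.continuous_ofReal.continuousAt.eventually h1).mono fun t ht => ht.comp_ofReal.deriv
  rw [he.deriv_eq, h2.comp_ofReal.deriv]

/-! ### The first order operator applied to a multiple of the tau-function -/

/-- The Hamiltonian and `α`-dependent terms add up to the partial fractions of `½ Tr A(z)²`. -/
theorem half_trace_sq_eq_sum_hamiltonian {A : Fin n → Fin 2 → Param n → Mat2} {p : Param n}
    {α : Fin n → ℂ} (hp : Function.Injective p.1) (htr : ∀ i k, (A i k p).trace = 0)
    (hs : ∀ i, p.2 i ≠ 0) (h : ∀ i, HasFormalExponent A i p (α i)) {K : Fin n → ℂ}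
    (hK : ∀ i, IsHamiltonianBirkhoff A i p (K i)) {z : ℂ} (hz : ∀ i, z ≠ p.1 i) :
    1 / 2 * ((laxMatrix A z p) ^ 2).trace =
      ∑ i, (1 / (z - p.1 i) * hamiltonianPole A i p + p.2 i / (z - p.1 i) ^ 2 * K i
        + (α i ^ 2 / (z - p.1 i) ^ 2 + 2 * p.2 i * α i / (z - p.1 i) ^ 3
          + p.2 i ^ 2 / (z - p.1 i) ^ 4)) := by
  rw [half_trace_sq_laxMatrix hp hz]
  refine Finset.sum_congr rfl fun i _ => ?_
  rw [hamiltonianPole_eq hp (h i), (h i).trace_mul.1, (h i).trace_mul.2]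
  linear_combination (-1 / (z - p.1 i) ^ 2) * (hK i).mul_eq hp htr (hs i) (h i)

/-- The operator `𝓛` on `τ F`, where `∂F/∂λᵢ = Tr (X (Uᵢ(z) - Bᵢ) Q)` and
`∂F/∂sᵢ = Tr (X (Vᵢ(z) - Cᵢ) Q)`: the derivatives of `τ` combine with the potential terms into
`½ Tr A(z)²`, and those of `F` into `∂A/∂z`. -/
theorem bpzSum_tau_mul {W : Set (Param n)} {A : Fin n → Fin 2 → Param n → Mat2}
    {τ : Param n → ℂ} {α : Fin n → ℂ} {l s : Fin n → ℂ} (hτ : IsTauFunction W A τ)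
    (hW : (l, s) ∈ W) (hp : Function.Injective l) (htr : ∀ i k, (A i k (l, s)).trace = 0)
    (hs : ∀ i, s i ≠ 0) (h : ∀ i, HasFormalExponent A i (l, s) (α i)) {z : ℂ}
    (hz : ∀ i, z ≠ l i) {F : Param n → ℂ} {X Q : Mat2} {B C : Fin n → Mat2}
    (hFl : ∀ i, HasDerivAt (fun w => F (Function.update l i w, s))
      (X * ((laxU A i z (l, s) - B i) * Q)).trace (l i))
    (hFs : ∀ i, HasDerivAt (fun w => F (l, Function.update s i w))
      (X * ((laxV A i z (l, s) - C i) * Q)).trace (s i)) :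
    bpzSum α z (fun p => τ p * F p) l s =
      τ (l, s) * ((X * ((laxQuotient A z z (l, s)
        - ∑ i, ((z - l i)⁻¹ • B i + (s i / (z - l i) ^ 2) • C i)) * Q)).trace
      + 1 / 2 * ((laxMatrix A z (l, s)) ^ 2).trace * F (l, s)) := by
  have hτ0 := hτ.ne_zero _ hW
  have hτd := (hτ.holomorphic _ hW).differentiableAt
  have hτl : ∀ i, HasDerivAt (fun w => τ (Function.update l i w, s))
      (hamiltonianPole A i (l, s) * τ (l, s)) (l i) := fun i => by
    have hd : DifferentiableAt ℂ (fun w => τ (Function.update l i w, s)) (l i) := by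
      refine DifferentiableAt.comp (l i) (g := τ) (f := fun w => (Function.update l i w, s)) ?_
        ((hasDerivAt_update l i (l i)).differentiableAt.prodMk (differentiableAt_const s))
      simpa using hτd
    have := hτ.eq_pole l s hW i
    rw [logDeriv_apply, Function.update_eq_self, div_eq_iff hτ0] at this
    rw [← this]
    exact hd.hasDerivAt
  have hτs : ∀ i, HasDerivAt (fun w => τ (l, Function.update s i w))
      (logDeriv (fun w => τ (l, Function.update s i w)) (s i) * τ (l, s)) (s i) := fun i => by
    have hd : DifferentiableAt ℂ (fun w => τ (l, Function.update s i w)) (s i) := by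
      refine DifferentiableAt.comp (s i) (g := τ) (f := fun w => (l, Function.update s i w)) ?_
        ((differentiableAt_const l).prodMk (hasDerivAt_update s i (s i)).differentiableAt)
      simpa using hτd
    rw [logDeriv_apply, Function.update_eq_self, div_mul_cancel₀ _ hτ0]
    exact hd.hasDerivAt
  have hsplit : (X * ((laxQuotient A z z (l, s)
        - ∑ i, ((z - l i)⁻¹ • B i + (s i / (z - l i) ^ 2) • C i)) * Q)).trace =
      ∑ i, ((z - l i)⁻¹ * (X * ((laxU A i z (l, s) - B i) * Q)).trace
        + s i / (z - l i) ^ 2 * (X * ((laxV A i z (l, s) - C i) * Q)).trace) := by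
    rw [laxQuotient, ← Finset.sum_sub_distrib, Finset.sum_mul, Finset.mul_sum, Matrix.trace_sum]
    refine Finset.sum_congr rfl fun i _ => ?_
    simp only [Matrix.mul_add, Matrix.mul_sub, Matrix.add_mul, Matrix.sub_mul, Matrix.smul_mul,
      Matrix.mul_smul, Matrix.trace_add, Matrix.trace_sub, Matrix.trace_smul, smul_eq_mul]
    ring
  rw [hsplit, half_trace_sq_eq_sum_hamiltonian hp htr hs h (hτ.eq_birkhoff l s hW) hz, bpzSum,
    Finset.sum_mul, ← Finset.sum_add_distrib, Finset.mul_sum]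
  refine Finset.sum_congr rfl fun i _ => ?_
  rw [wirtinger_eq_of_hasDerivAt ((hτl i).fun_mul (hFl i)),
    wirtinger_eq_of_hasDerivAt ((hτs i).fun_mul (hFs i))]
  simp only [Function.update_eq_self]
  ring

/-! ### Regularity -/

/-- Partial derivatives of a smooth function on an open set are smooth. -/
theorem _root_.ContDiffOn.smooth_fderiv_apply {E F : Type*} [NormedAddCommGroup E]
    [NormedSpace ℝ E] [NormedAddCommGroup F] [NormedSpace ℝ F] {f : E → F} {D : Set E}
    (hf : ContDiffOn ℝ (⊤ : ℕ∞) f D) (hD : IsOpen D) (v : E) :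
    ContDiffOn ℝ (⊤ : ℕ∞) (fun x => fderiv ℝ f x v) D :=
  (hf.fderiv_of_isOpen hD (by simp)).clm_apply contDiffOn_const

/-- The restriction to real `z`, `ξ` of a holomorphic function of `(z, ξ, λ; s)` belongs to
`C^{2,1}_hol`. -/
theorem isC21Hol_of_analyticOnNhd {E : Set (ℂ × ℂ × Param n)} {G : ℂ × ℂ × Param n → ℂ}
    (hE : IsOpen E) (hG : AnalyticOnNhd ℂ G E) {D : Set (ℝ × ℝ × Param n)} (hD : IsOpen D)
    (hDE : ∀ x ∈ D, ((x.1 : ℂ), (x.2.1 : ℂ), x.2.2) ∈ E) :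
    IsC21Hol D (fun x => G ((x.1 : ℂ), (x.2.1 : ℂ), x.2.2)) := by
  set f : ℝ × ℝ × Param n → ℂ := fun x => G ((x.1 : ℂ), (x.2.1 : ℂ), x.2.2) with hf
  have hι : ContDiff ℝ (⊤ : ℕ∞) (fun x : ℝ × ℝ × Param n => ((x.1 : ℂ), (x.2.1 : ℂ), x.2.2)) :=
    (Complex.ofRealCLM.contDiff.comp contDiff_fst).prodMk
      ((Complex.ofRealCLM.contDiff.comp (contDiff_fst.comp contDiff_snd)).prodMk
        (contDiff_snd.comp contDiff_snd))
  have hsm : ContDiffOn ℝ (⊤ : ℕ∞) f D :=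
    ((hG.contDiffOn hE.uniqueDiffOn).restrict_scalars ℝ).comp hι.contDiffOn hDE
  have hat : ∀ x ∈ D, ContDiffAt ℝ (⊤ : ℕ∞) f x := fun x hx => hsm.contDiffAt (hD.mem_nhds hx)
  have slice₁ : ∀ {h : ℝ × ℝ × Param n → ℂ}, ContDiffOn ℝ (⊤ : ℕ∞) h D → ∀ x ∈ D,
      deriv (fun t : ℝ => h (t, x.2)) x.1 = fderiv ℝ h x (1, 0) := fun {h} hh x hx => by
    have hd : HasFDerivAt h (fderiv ℝ h x) (x.1, x.2) :=
      ((hh.contDiffAt (hD.mem_nhds hx)).differentiableAt (by simp)).hasFDerivAt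
    have hl : HasDerivAt (fun t : ℝ => (t, x.2)) (1, 0) x.1 :=
      (hasDerivAt_id x.1).prodMk (hasDerivAt_const x.1 x.2)
    exact (hd.comp_hasDerivAt x.1 hl).deriv
  have hsm₁ := hsm.smooth_fderiv_apply hD ((1 : ℝ), (0 : ℝ × Param n))
  refine ⟨fun z ξ p hx => ?_, fun z ξ p hx => ?_, fun z ξ p hx => ?_, hsm.continuousOn, ?_, ?_, ?_⟩
  · exact ((hat _ hx).of_le (WithTop.coe_le_coe.2 (le_top : (2 : ℕ∞) ≤ ⊤))).comp z
      (f := fun t : ℝ => (t, ξ, p)) (contDiffAt_id.prodMk contDiffAt_const)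
  · exact ((hat _ hx).of_le (by exact_mod_cast le_top)).comp ξ
      (f := fun t : ℝ => (z, t, p)) (contDiffAt_const.prodMk (contDiffAt_id.prodMk contDiffAt_const))
  · exact (hG _ (hDE _ hx)).comp_of_eq (f := fun q : Param n => ((z : ℂ), (ξ : ℂ), q))
      (analyticAt_const.prod (analyticAt_const.prod analyticAt_id)) rfl
  · exact hsm₁.continuousOn.congr (slice₁ hsm)
  · refine (hsm₁.smooth_fderiv_apply hD ((1 : ℝ), (0 : ℝ × Param n))).continuousOn.congr
      fun x hx => ?_
    refine Eq.trans ?_ (slice₁ hsm₁ x hx)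
    rw [iteratedDeriv_succ, iteratedDeriv_one]
    refine EventuallyEq.deriv_eq ?_
    have hc : ContinuousAt (fun t : ℝ => (t, x.2)) x.1 := by fun_prop
    filter_upwards [hc.eventually (hD.mem_nhds hx)] with t ht
    exact slice₁ hsm _ ht
  · refine (hsm.smooth_fderiv_apply hD ((0 : ℝ), (1 : ℝ), (0 : Param n))).continuousOn.congr
      fun x hx => ?_
    have hd : HasFDerivAt f (fderiv ℝ f x) (x.1, x.2.1, x.2.2) :=
      ((hat x hx).differentiableAt (by simp)).hasFDerivAt
    have hl : HasDerivAt (fun t : ℝ => (x.1, t, x.2.2)) (0, 1, 0) x.2.1 :=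
      (hasDerivAt_const x.2.1 x.1).prodMk
        ((hasDerivAt_id x.2.1).prodMk (hasDerivAt_const x.2.1 x.2.2))
    exact (hd.comp_hasDerivAt x.2.1 hl).deriv

/-- The restriction to real `z` of a holomorphic function of `(z, λ; s)` belongs to `C²_hol`. -/
theorem isC2Hol_of_analyticOnNhd {E : Set (ℂ × Param n)} {G : ℂ × Param n → ℂ}
    (hE : IsOpen E) (hG : AnalyticOnNhd ℂ G E) {D : Set (ℝ × Param n)}
    (hDE : ∀ x ∈ D, ((x.1 : ℂ), x.2) ∈ E) :
    IsC2Hol D (fun x => G ((x.1 : ℂ), x.2)) := by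
  refine ⟨?_, fun z p hx => ?_⟩
  · have hι : ContDiff ℝ 2 (fun x : ℝ × Param n => ((x.1 : ℂ), x.2)) :=
      (Complex.ofRealCLM.contDiff.comp contDiff_fst).prodMk contDiff_snd
    exact ((hG.contDiffOn hE.uniqueDiffOn).restrict_scalars ℝ).comp hι.contDiffOn hDE
  · exact (hG _ (hDE _ hx)).comp_of_eq (f := fun q : Param n => ((z : ℂ), q))
      (analyticAt_const.prod analyticAt_id) rfl

/-! ### The confluent BPZ equations -/

/-- For a constant matrix `X`, `∂²/∂z² Tr (X Y) = Tr (X ∂A/∂z Y) + ½ Tr (A²) Tr (X Y)`. -/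
theorem IsIsomonodromicSolution.iteratedDeriv_two {W : Set (Param n)} {Ω : Set (ℂ × Param n)}
    {α : Fin n → ℂ} {A : Fin n → Fin 2 → Param n → Mat2} {Y : ℂ × Param n → Mat2}
    (hY : IsIsomonodromicSolution W Ω α A Y) (hΩ : IsOpen Ω) {p : Param n} (hpW : p ∈ W)
    (hs : ∀ i, p.2 i ≠ 0) (hΩ_ne : ∀ x ∈ Ω, ∀ i, x.1 ≠ x.2.1 i) {z : ℝ} (hz : ((z : ℂ), p) ∈ Ω)
    (c : ℂ) (X : Mat2) :
    iteratedDeriv 2 (fun t : ℝ => c * (X * Y ((t : ℂ), p)).trace) z =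
      c * ((X * (laxQuotient A z z p * Y (z, p))).trace
        + 1 / 2 * ((laxMatrix A z p) ^ 2).trace * (X * Y (z, p)).trace) := by
  have hev : ∀ᶠ w in 𝓝 (z : ℂ), (w, p) ∈ Ω :=
    (ContinuousAt.prodMk continuousAt_id continuousAt_const).eventually (hΩ.mem_nhds hz)
  have h2 := (hasDerivAt_trace_mul X (hasDerivAt_mul_apply
    (hasDerivAt_laxMatrix (A := A) hs (hΩ_ne _ hz)) (hY.eq_z z p.1 p.2 hz))).const_mul c
  rw [iteratedDeriv_two_comp_ofReal (f := fun w => c * (X * Y (w, p)).trace)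
    (hev.mono fun w hw => (hasDerivAt_trace_mul X (hY.eq_z w p.1 p.2 hw)).const_mul c) h2,
    ← Matrix.mul_assoc (laxMatrix A z (p.1, p.2)),
    sq_eq_of_trace_eq_zero (trace_laxMatrix (hY.traceless p hpW) z), Matrix.mul_add,
    Matrix.trace_add, Matrix.smul_mul, Matrix.one_mul, Matrix.mul_smul, Matrix.trace_smul,
    smul_eq_mul]

theorem IsIsomonodromicSolution.analyticOnNhd_trace_inv_mul {W : Set (Param n)} {Ω : Set (ℂ × Param n)}
    {α : Fin n → ℂ} {A : Fin n → Fin 2 → Param n → Mat2} {Y : ℂ × Param n → Mat2}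
    {τ : Param n → ℂ} (hY : IsIsomonodromicSolution W Ω α A Y) (hτ : IsTauFunction W A τ)
    (hΩ_param : ∀ x ∈ Ω, x.2 ∈ W) :
    AnalyticOnNhd ℂ (fun x : ℂ × ℂ × Param n =>
        τ x.2.2 * ((Y (x.2.1, x.2.2))⁻¹ * Y (x.1, x.2.2)).trace)
      ({x | (x.1, x.2.2) ∈ Ω} ∩ {x | (x.2.1, x.2.2) ∈ Ω}) := by
  rintro ⟨z, ξ, p⟩ ⟨hz, hξ⟩
  have a₁ : ∀ a b, AnalyticAt ℂ (fun x : ℂ × ℂ × Param n => Y (x.1, x.2.2) a b) (z, ξ, p) :=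
    fun a b => (hY.holomorphic a b _ hz).comp_of_eq
      (f := fun x : ℂ × ℂ × Param n => (x.1, x.2.2))
      (analyticAt_fst.prod (analyticAt_snd.comp analyticAt_snd)) rfl
  have a₂ : ∀ a b, AnalyticAt ℂ (fun x : ℂ × ℂ × Param n => Y (x.2.1, x.2.2) a b) (z, ξ, p) :=
    fun a b => (hY.holomorphic a b _ hξ).comp_of_eq
      (f := fun x : ℂ × ℂ × Param n => (x.2.1, x.2.2)) analyticAt_snd rfl
  have a₃ : AnalyticAt ℂ (fun x : ℂ × ℂ × Param n => τ x.2.2) (z, ξ, p) :=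
    (hτ.holomorphic p (hΩ_param _ hz)).comp_of_eq
      (f := fun x : ℂ × ℂ × Param n => x.2.2)
      (analyticAt_snd.comp analyticAt_snd) rfl
  have hd := (hY.invertible _ hξ).ne_zero
  rw [Matrix.det_fin_two] at hd
  simp only [trace_inv_mul]
  exact a₃.fun_mul (((((a₂ 0 0).fun_mul (a₂ 1 1)).fun_sub ((a₂ 0 1).fun_mul (a₂ 1 0))).fun_inv
    hd).fun_mul (((((a₂ 1 1).fun_mul (a₁ 0 0)).fun_sub ((a₂ 0 1).fun_mul (a₁ 1 0))).fun_sub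
      ((a₂ 1 0).fun_mul (a₁ 0 1))).fun_add ((a₂ 0 0).fun_mul (a₁ 1 1))))

/-- Relative to the equation without `ξ`, the derivatives of `Y(ξ)⁻¹` in the parameters contribute
`-Tr (Y(ξ)⁻¹ (A(z) - A(ξ)) Y(z)) / (z - ξ)`, which is what `-(∂_z + ∂_ξ) / (z - ξ)` produces. -/
theorem IsIsomonodromicSolution.confluentBPZForce {W : Set (Param n)} {Ω : Set (ℂ × Param n)}
    {α : Fin n → ℂ} {A : Fin n → Fin 2 → Param n → Mat2} {Y : ℂ × Param n → Mat2}
    {τ : Param n → ℂ} (hY : IsIsomonodromicSolution W Ω α A Y) (hτ : IsTauFunction W A τ)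
    (hΩ : IsOpen Ω) (hW_distinct : ∀ p ∈ W, Function.Injective p.1)
    (hW_ne : ∀ p ∈ W, ∀ i, p.2 i ≠ 0) (hΩ_param : ∀ x ∈ Ω, x.2 ∈ W)
    (hΩ_ne : ∀ x ∈ Ω, ∀ i, x.1 ≠ x.2.1 i) {z ξ : ℝ} {l s : Fin n → ℂ} (hne : z ≠ ξ)
    (hz : ((z : ℂ), l, s) ∈ Ω) (hξ : ((ξ : ℂ), l, s) ∈ Ω) :
    iteratedDeriv 2 (fun t : ℝ => τ (l, s) * ((Y ((ξ : ℂ), l, s))⁻¹ * Y ((t : ℂ), l, s)).trace) z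
      - 1 / ((z : ℂ) - (ξ : ℂ)) *
        (deriv (fun t : ℝ => τ (l, s) * ((Y ((ξ : ℂ), l, s))⁻¹ * Y ((t : ℂ), l, s)).trace) z
        + deriv (fun t : ℝ => τ (l, s) * ((Y ((t : ℂ), l, s))⁻¹ * Y ((z : ℂ), l, s)).trace) ξ)
      - bpzSum α (z : ℂ) (fun p => τ p * ((Y ((ξ : ℂ), p))⁻¹ * Y ((z : ℂ), p)).trace) l s = 0 := by
  have hp : (l, s) ∈ W := hΩ_param _ hz
  have htr := hY.traceless _ hp
  have hs := hW_ne _ hp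
  have hu := hY.invertible _ hξ
  have hzξ : (z : ℂ) - ξ ≠ 0 := sub_ne_zero.2 (by exact_mod_cast hne)
  have hdz : deriv (fun t : ℝ => τ (l, s) * ((Y ((ξ : ℂ), l, s))⁻¹ * Y ((t : ℂ), l, s)).trace) z
      = τ (l, s) * ((Y (ξ, l, s))⁻¹ * (laxMatrix A z (l, s) * Y (z, l, s))).trace :=
    ((hasDerivAt_trace_mul _ (hY.eq_z z l s hz)).const_mul (τ (l, s))).comp_ofReal.deriv
  have hdξ' : HasDerivAt (fun w => ((Y (w, l, s))⁻¹ * Y ((z : ℂ), l, s)).trace)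
      ((Y (ξ, l, s))⁻¹ * ((0 - laxMatrix A ξ (l, s)) * Y (z, l, s))).trace (ξ : ℂ) := by
    refine hasDerivAt_trace_inv_mul (P := fun w => Y (w, l, s)) (Q := fun _ => Y (z, l, s))
      (trace_laxMatrix htr ξ) rfl rfl hu (hY.eq_z ξ l s hξ) fun a b => ?_
    rw [Matrix.zero_mul, Matrix.zero_apply]
    exact hasDerivAt_const _ _
  have hdξ : deriv (fun t : ℝ => τ (l, s) * ((Y ((t : ℂ), l, s))⁻¹ * Y ((z : ℂ), l, s)).trace) ξ
      = τ (l, s) * ((Y (ξ, l, s))⁻¹ * ((0 - laxMatrix A ξ (l, s)) * Y (z, l, s))).trace :=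
    (hdξ'.const_mul (τ (l, s))).comp_ofReal.deriv
  have hFl : ∀ i, HasDerivAt (fun w => ((Y ((ξ : ℂ), Function.update l i w, s))⁻¹
      * Y ((z : ℂ), Function.update l i w, s)).trace)
      ((Y (ξ, l, s))⁻¹ * ((laxU A i z (l, s) - laxU A i ξ (l, s)) * Y (z, l, s))).trace (l i) :=
    fun i => hasDerivAt_trace_inv_mul
      (P := fun w => Y (ξ, Function.update l i w, s))
      (Q := fun w => Y (z, Function.update l i w, s)) (trace_laxU htr i ξ) (by rw [Function.update_eq_self])
      (by rw [Function.update_eq_self]) hu (hY.eq_pole ξ l s hξ i) (hY.eq_pole z l s hz i)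
  have hFs : ∀ i, HasDerivAt (fun w => ((Y ((ξ : ℂ), l, Function.update s i w))⁻¹
      * Y ((z : ℂ), l, Function.update s i w)).trace)
      ((Y (ξ, l, s))⁻¹ * ((laxV A i z (l, s) - laxV A i ξ (l, s)) * Y (z, l, s))).trace (s i) :=
    fun i => hasDerivAt_trace_inv_mul
      (P := fun w => Y (ξ, l, Function.update s i w))
      (Q := fun w => Y (z, l, Function.update s i w)) (trace_laxV htr i ξ) (by rw [Function.update_eq_self])
      (by rw [Function.update_eq_self]) hu (hY.eq_birkhoff ξ l s hξ i)
      (hY.eq_birkhoff z l s hz i)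
  have hL := bpzSum_tau_mul hτ hp (hW_distinct _ hp) htr hs (hY.formal _ hp) (hΩ_ne _ hz)
    (F := fun p => ((Y ((ξ : ℂ), p))⁻¹ * Y ((z : ℂ), p)).trace) hFl hFs
  have hquot : ((Y (ξ, l, s))⁻¹ * (laxMatrix A z (l, s) * Y (z, l, s))).trace
      + ((Y (ξ, l, s))⁻¹ * ((0 - laxMatrix A ξ (l, s)) * Y (z, l, s))).trace
      = (z - ξ) * ((Y (ξ, l, s))⁻¹ * (laxQuotient A z ξ (l, s) * Y (z, l, s))).trace := by
    rw [← Matrix.trace_add, ← Matrix.mul_add, ← Matrix.add_mul, zero_sub, ← sub_eq_add_neg,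
      laxMatrix_sub_laxMatrix hs (hΩ_ne _ hz) (hΩ_ne _ hξ), Matrix.smul_mul, Matrix.mul_smul,
      Matrix.trace_smul, smul_eq_mul]
  have hM : laxQuotient A z ξ (l, s) = ∑ i, (((z : ℂ) - l i)⁻¹ • laxU A i ξ (l, s)
      + (s i / ((z : ℂ) - l i) ^ 2) • laxV A i ξ (l, s)) := rfl
  rw [hY.iteratedDeriv_two hΩ hp hs hΩ_ne hz, hdz, hdξ, ← mul_add, hquot, hL, ← hM,
    Matrix.sub_mul, Matrix.mul_sub, Matrix.trace_sub]
  field_simp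
  ring

end IrregularBPZ

open IrregularBPZ in
theorem mainTheorem9 {n : ℕ}
    (W : Set (IrregularBPZ.Param n)) (hW : IsOpen W)
    (hW_distinct : ∀ p ∈ W, Function.Injective p.1)
    (hW_ne : ∀ p ∈ W, ∀ i, p.2 i ≠ 0)
    (Ω : Set (ℂ × IrregularBPZ.Param n)) (hΩ : IsOpen Ω)
    (hΩ_param : ∀ x ∈ Ω, x.2 ∈ W)
    (hΩ_ne : ∀ x ∈ Ω, ∀ i, x.1 ≠ x.2.1 i)
    (α : Fin n → ℂ)
    (A : Fin n → Fin 2 → IrregularBPZ.Param n → IrregularBPZ.Mat2)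
    (Y : ℂ × IrregularBPZ.Param n → IrregularBPZ.Mat2)
    (τ : IrregularBPZ.Param n → ℂ)
    (hY : IrregularBPZ.IsIsomonodromicSolution W Ω α A Y)
    (hτ : IrregularBPZ.IsTauFunction W A τ) :
    IrregularBPZ.SolvesConfluentBPZForce α
      {x | x.1 ≠ x.2.1 ∧ ((x.1 : ℂ), x.2.2) ∈ Ω ∧ ((x.2.1 : ℂ), x.2.2) ∈ Ω}
      (fun x => τ x.2.2 * ((Y ((x.2.1 : ℂ), x.2.2))⁻¹ * Y ((x.1 : ℂ), x.2.2)).trace) ∧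
    IrregularBPZ.SolvesConfluentBPZ α
      {x | ((x.1 : ℂ), x.2) ∈ Ω}
      (fun x => τ x.2 * (Y ((x.1 : ℂ), x.2)).trace) := by
  refine ⟨⟨?_, ?_⟩, ⟨?_, ?_⟩⟩
  · have hc₁ : Continuous fun x : ℂ × ℂ × Param n => (x.1, x.2.2) := by fun_prop
    have hc₂ : Continuous fun x : ℂ × ℂ × Param n => (x.2.1, x.2.2) := by fun_prop
    have hE := (hΩ.preimage hc₁).inter (hΩ.preimage hc₂)
    have hι : Continuous fun x : ℝ × ℝ × Param n => ((x.1 : ℂ), (x.2.1 : ℂ), x.2.2) := by fun_prop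
    have hne : IsOpen {x : ℝ × ℝ × Param n | x.1 ≠ x.2.1} :=
      isOpen_ne_fun (by fun_prop) (by fun_prop)
    refine isC21Hol_of_analyticOnNhd
      (G := fun x => τ x.2.2 * ((Y (x.2.1, x.2.2))⁻¹ * Y (x.1, x.2.2)).trace)
      hE (hY.analyticOnNhd_trace_inv_mul hτ hΩ_param) (hne.inter (hE.preimage hι)) fun x hx => hx.2
  · rintro z ξ l s ⟨hne, hz, hξ⟩
    exact hY.confluentBPZForce hτ hΩ hW_distinct hW_ne hΩ_param hΩ_ne hne hz hξ
  · refine isC2Hol_of_analyticOnNhd (G := fun x => τ x.2 * (Y x).trace) hΩ ?_ fun x hx => hx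
    intro x hx
    have a₃ : AnalyticAt ℂ (fun x : ℂ × Param n => τ x.2) x :=
      (hτ.holomorphic x.2 (hΩ_param _ hx)).comp_of_eq
        (f := fun x : ℂ × Param n => x.2) analyticAt_snd rfl
    simp only [Matrix.trace_fin_two]
    exact a₃.fun_mul ((hY.holomorphic 0 0 x hx).fun_add (hY.holomorphic 1 1 x hx))
  · intro z l s hz
    have hp : (l, s) ∈ W := hΩ_param _ hz
    have htr := hY.traceless _ hp
    have hs := hW_ne _ hp
    have h2 := hY.iteratedDeriv_two hΩ hp hs hΩ_ne hz (τ (l, s)) 1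
    have hL := bpzSum_tau_mul hτ hp (hW_distinct _ hp) htr hs (hY.formal _ hp) (hΩ_ne _ hz)
      (F := fun p => (1 * Y ((z : ℂ), p)).trace) (X := 1) (Q := Y (z, l, s))
      (B := fun _ => 0) (C := fun _ => 0)
      (fun i => hasDerivAt_trace_mul 1 (by simpa only [sub_zero] using hY.eq_pole z l s hz i))
      (fun i => hasDerivAt_trace_mul 1 (by simpa only [sub_zero] using hY.eq_birkhoff z l s hz i))
    simp only [Matrix.one_mul, smul_zero, add_zero, Finset.sum_const_zero, sub_zero] at h2 hL
    exact sub_eq_zero.2 (h2.trans hL.symm)
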